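/- Let $(R,\mathfrak m)$ be a regular local ring of dimension $d \ge 2$ with fraction field $K$, and let $x_1,\dots,x_d$ be elements with $\mathfrak m=(x_1,\dots,x_d)R$. Put $R_0=R$ and $x_{0,i}=x_i$, and let $R=R_0\subset R_1\subset R_2\subset\cdots\subset K$ be an infinite sequence of monomial local quadratic transforms: for every $n\ge 0$ a direction $w_n\in\{1,\dots,d\}$ is given, one sets $x_{n+1,w_n}=x_{n,w_n}$ and $x_{n+1,i}=x_{n,i}/x_{n,w_n}$ for $i\ne w_n$, and $R_{n+1}$ is the localization of $R_n[\mathfrak m_n/x_{n,w_n}]$ at the prime ideal generated by $x_{n+1,1},\dots,x_{n+1,d}$, where $\mathfrak m_n$ is the maximal ideal of $R_n$. Assume that every direction occurs infinitely often, that is, for each $i\in\{1,\dots,d\}$ the set $\{n\ge 0 : w_n=i\}$ is infinite. Let $S=\bigcup_{n\ge0}R_n$, a local ring, let $V$ be a valuation domain with $S\subseteq V\subseteq K$ whose maximal ideal contracts to the maximal ideal of $S$, and let $v$ be a valuation of $K$ with valuation ring $V$ and value group $\Gamma_v$. Then: 1. $V$ has rational rank $d$, that is, $\dim_{\mathbb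 Q}(\Gamma_v\otimes_{\mathbb Z}\mathbb Q)=d$. 2. $V$ dominates $R$ and is zero-dimensional over $R$, that is, the residue field of $V$ has transcendence degree $0$ over $R/\mathfrak m$. 3. The values $v(x_1),\dots,v(x_d)$ are rationally independent, that is, linearly independent over $\mathbb Q$ in $\Gamma_v\otimes_{\mathbb Z}\mathbb Q$. 4. $v$ is a monomial valuation with respect to $x_1,\dots,x_d$: every nonzero $f\in R$ can be written as $f=\sum_{a\in E}u_a x_1^{a_1}\cdots x_d^{a_d}$ with $E\subset\mathbb N_0^d$ finite and units $u_a\in R$, and for every such expression $v(f)=\min_{a\in E}v(x_1^{a_1}\cdots x_d^{a_d})$. -/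

import Mathlib

open scoped TensorProduct

/-- The subring `A[𝔪_A / w]` of `K`, for a local subring `A` of the field `K`. -/
def quadraticDilatation {K : Type*} [Field K] (A : LocalSubring K) (w : K) : Subring K :=
  Subring.closure
    ((A.toSubring : Set K) ∪ {k | ∃ a ∈ IsLocalRing.maximalIdeal A.toSubring, k = (a : K) / w})

/-- The elements obtained from `x` by the monomial transform in the direction `w`:
`x w` is kept, and every other `x i` is divided by `x w`. -/
def transformVariables {K : Type*} [Field K] {d : ℕ} (x : Fin d → K) (w : Fin d) : Fin d → K :=
  fun i => if i = w then x w else x i / x w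

/-- The variables `(x_n, y_n, …, z_n)` of the `n`-th ring of a sequence of monomial transforms
whose `n`-th step is in the direction `dir n`. -/
def monomialVariables {K : Type*} [Field K] {d : ℕ} (x : Fin d → K) (dir : ℕ → Fin d) :
    ℕ → Fin d → K
  | 0 => x
  | n + 1 => transformVariables (monomialVariables x dir n) (dir n)

/-- `B` is the monomial local quadratic transform of the local ring `A`, whose maximal ideal is
generated by `x`, in the direction `w`: it is the localization of `A[𝔪_A / x w]` at the prime ideal
generated by the new variables `x w` and `x i / x w` for `i ≠ w`. -/
def IsMonomialQuadraticTransform {K : Type*} [Field K] {d : ℕ} (A : LocalSubring K)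
    (x : Fin d → K) (w : Fin d) (B : LocalSubring K) : Prop :=
  ∃ (P : Ideal (quadraticDilatation A (x w))) (_ : P.IsPrime),
    P = Ideal.span {b : quadraticDilatation A (x w) | ∃ i, (b : K) = transformVariables x w i} ∧
    B = LocalSubring.ofPrime (quadraticDilatation A (x w)) P

/-- `R = A 0 ⊂ A 1 ⊂ A 2 ⊂ ⋯`, inside the fraction field `K` of `R`, is the sequence of monomial
local quadratic transforms with respect to `x`, where the transform from `A n` to `A (n + 1)`
is in the direction `dir n`. -/
def IsMonomialQuadraticSequence {R K : Type*} [CommRing R] [Field K] [Algebra R K] {d : ℕ}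
    (x : Fin d → R) (dir : ℕ → Fin d) (A : ℕ → LocalSubring K) : Prop :=
  (A 0).toSubring = (algebraMap R K).range ∧
  ∀ n, IsMonomialQuadraticTransform (A n)
    (monomialVariables (fun i => algebraMap R K (x i)) dir n) (dir n) (A (n + 1))

/-- The valuation ring `V` of `K` dominates the ring `S` (local, with fraction field `K`):
`S` maps into `V`, and the nonunits of `S` (its maximal ideal) are exactly the elements of `S` that
lie in the maximal ideal of `V`. Since the fraction field of `S` is `K`, this is birational
domination. -/
def BirationallyDominates (S : Type*) {K : Type*} [CommRing S] [Field K] [Algebra S K]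
    (V : ValuationSubring K) : Prop :=
  ∃ h : ∀ s, algebraMap S K s ∈ V, IsLocalHom ((algebraMap S K).codRestrict V h)

/-- `V` dominates the local ring `R`, and the transcendence degree of the residue field of `V`
over the residue field of `R` is `t`, that is, `V` has dimension `t` over `R`. -/
def HasDimensionOver (R : Type*) {K : Type*} [CommRing R] [IsLocalRing R] [Field K] [Algebra R K]
    (V : ValuationSubring K) (t : Cardinal) : Prop :=
  ∃ (h : ∀ r, algebraMap R K r ∈ V) (_ : IsLocalHom ((algebraMap R K).codRestrict V h)),
    letI : Algebra (IsLocalRing.ResidueField R) (IsLocalRing.ResidueField V) :=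
      (IsLocalRing.ResidueField.map ((algebraMap R K).codRestrict V h)).toAlgebra
    Algebra.trdeg (IsLocalRing.ResidueField R) (IsLocalRing.ResidueField V) = t

/-- The value group `v(Kˣ)`, written additively. -/
abbrev AddValueGroup {K Γ₀ : Type*} [Field K] [LinearOrderedCommGroupWithZero Γ₀]
    (v : Valuation K Γ₀) : Type _ :=
  Additive (MonoidWithZeroHom.valueGroup v.toMonoidWithZeroHom)

/-- The rational rank of `v`: the dimension of the `ℚ`-vector space `ℚ ⊗ Γ_v`. -/
noncomputable def ratRank {K Γ₀ : Type*} [Field K] [LinearOrderedCommGroupWithZero Γ₀]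
    (v : Valuation K Γ₀) : Cardinal :=
  Module.rank ℚ (ℚ ⊗[ℤ] AddValueGroup v)

/-- The elements `y i` are nonzero and their values `v (y i)` are rationally independent:
their images in `ℚ ⊗ Γ_v` are linearly independent over `ℚ`. -/
def RationallyIndependentValues {K Γ₀ ι : Type*} [Field K] [LinearOrderedCommGroupWithZero Γ₀]
    (v : Valuation K Γ₀) (y : ι → K) : Prop :=
  ∃ γ : ι → MonoidWithZeroHom.valueGroup v.toMonoidWithZeroHom,
    (∀ i, ((γ i : Γ₀ˣ) : Γ₀) = v (y i)) ∧
    LinearIndependent ℚ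
      (fun i => ((1 : ℚ) ⊗ₜ[ℤ] Additive.ofMul (γ i) : ℚ ⊗[ℤ] AddValueGroup v))

/-- The monomial with exponents `a` in the elements `x`. -/
def monomialIn {R : Type*} [CommRing R] {d : ℕ} (x : Fin d → R) (a : Fin d → ℕ) : R :=
  ∏ i, x i ^ a i

/-- `v` is a monomial valuation with respect to the regular parameters `x` of `R`: every nonzero
`f` in `R` is a sum of distinct monomials in `x` with unit coefficients, and for every such
expression the value of `f` is the minimum of the values of the monomials that occur.
(Values are written multiplicatively, so the minimum of the additive values is a maximum here.) -/
def IsMonomialValuation {R K Γ₀ : Type*} [CommRing R] [Field K] [Algebra R K]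
    [LinearOrderedCommGroupWithZero Γ₀] {d : ℕ} (x : Fin d → R) (v : Valuation K Γ₀) : Prop :=
  ∀ f : R, f ≠ 0 →
    (∃ (E : Finset (Fin d → ℕ)) (u : (Fin d → ℕ) → Rˣ),
      f = ∑ a ∈ E, (u a : R) * monomialIn x a) ∧
    ∀ (E : Finset (Fin d → ℕ)) (u : (Fin d → ℕ) → Rˣ),
      f = ∑ a ∈ E, (u a : R) * monomialIn x a →
      IsGreatest ((fun a => v (algebraMap R K (monomialIn x a))) '' E) (v (algebraMap R K f))

/-! Everything rests on the multiplicative independence of the `v (x i)`, which is read off from the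
sequence of transforms. In the new variables a Laurent monomial keeps its exponents, except that the
one in the chosen direction becomes the sum of them all. If every direction recurs and `2 ≤ d`, a
nonzero exponent vector eventually has all entries positive or all negative
(`exists_exponentSequence_pos_or_neg`). Domination gives the variables of every `A n` values less
than `1` (`map_monomialVariables_lt_one`), so no nontrivial Laurent monomial in `x` has value `1`
(`map_prod_zpow_ne_one`).

By independence, distinct monomials in `x` have distinct values, so a finite sum of them with unit
coefficients (`exists_unit_monomial_expansion`) is dominated by a single term; this makes `v`
monomial. Comparing the dominant terms of numerator and denominator of an element of `K` shows that
the value group is free on the `v (x i)` and that the residue field of `R` does not grow. -/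

/-- The exponents of a Laurent monomial after the transform of the variables in the direction `w`. -/
def stepExponents {d : ℕ} (c : Fin d → ℤ) (w : Fin d) : Fin d → ℤ :=
  fun i => if i = w then ∑ j, c j else c i

/-- The exponents, in the variables of the `n`-th ring, of the Laurent monomial which has exponents
`c` in the variables of the first ring. -/
def exponentSequence {d : ℕ} (c : Fin d → ℤ) (dir : ℕ → Fin d) : ℕ → Fin d → ℤ
  | 0 => c
  | n + 1 => stepExponents (exponentSequence c dir n) (dir n)

/-! ### Dynamics of exponent vectors under monomial transforms. -/

section Exponents

variable {d : ℕ} {c : Fin d → ℤ} {dir : ℕ → Fin d}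

theorem exponentSequence_succ_dir (n : ℕ) :
    exponentSequence c dir (n + 1) (dir n) = ∑ j, exponentSequence c dir n j := by
  simp [exponentSequence, stepExponents]

theorem exponentSequence_succ_of_ne {n : ℕ} {i : Fin d} (h : i ≠ dir n) :
    exponentSequence c dir (n + 1) i = exponentSequence c dir n i := by
  simp [exponentSequence, stepExponents, h]

theorem sum_exponentSequence_succ (n : ℕ) :
    ∑ j, exponentSequence c dir (n + 1) j =
      2 * ∑ j, exponentSequence c dir n j - exponentSequence c dir n (dir n) := by
  have h1 := Finset.add_sum_erase Finset.univ (exponentSequence c dir (n + 1))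
    (Finset.mem_univ (dir n))
  have h2 := Finset.add_sum_erase Finset.univ (exponentSequence c dir n)
    (Finset.mem_univ (dir n))
  have h3 : ∑ j ∈ Finset.univ.erase (dir n), exponentSequence c dir (n + 1) j =
      ∑ j ∈ Finset.univ.erase (dir n), exponentSequence c dir n j :=
    Finset.sum_congr rfl fun j hj => exponentSequence_succ_of_ne (Finset.ne_of_mem_erase hj)
  rw [exponentSequence_succ_dir] at h1
  linarith

theorem exponentSequence_neg (n : ℕ) (i : Fin d) :
    exponentSequence (-c) dir n i = -exponentSequence c dir n i := by
  induction n generalizing i with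
  | zero => rfl
  | succ n ih =>
    by_cases h : i = dir n
    · subst h
      simp [exponentSequence_succ_dir, ih]
    · rw [exponentSequence_succ_of_ne h, exponentSequence_succ_of_ne h, ih]

theorem exponentSequence_ne_zero (hc : c ≠ 0) (n : ℕ) : exponentSequence c dir n ≠ 0 := by
  induction n with
  | zero => exact hc
  | succ n ih =>
    intro h
    have hs : ∑ j, exponentSequence c dir n j = 0 := by
      rw [← exponentSequence_succ_dir, h]; rfl
    have hne : ∀ i, i ≠ dir n → exponentSequence c dir n i = 0 := fun i hi => by
      rw [← exponentSequence_succ_of_ne hi, h]; rfl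
    have hd : exponentSequence c dir n (dir n) = 0 := by
      rw [← hs, Finset.sum_eq_single_of_mem (dir n) (Finset.mem_univ _) fun j _ hj => hne j hj]
    exact ih (funext fun i => if hi : i = dir n then hi ▸ hd else hne i hi)

/-- A property of all the exponent sums from some step on is eventually one of all exponents. -/
theorem exists_forall_exponentSequence (hdir : ∀ i, {n | dir n = i}.Infinite) (n : ℕ) (P : ℤ → Prop)
    (h : ∀ m ≥ n, P (∑ j, exponentSequence c dir m j)) :
    ∃ N ≥ n, ∀ m ≥ N, ∀ i, P (exponentSequence c dir m i) := by
  -- From step `t i + 1` on, the exponent at `i` is always the exponent sum of some step `≥ n`: it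
  -- is such a sum then, and changes only to a later one.
  choose t ht hnt using fun i => (hdir i).exists_gt n
  have key : ∀ i m, P (exponentSequence c dir (t i + 1 + m) i) := by
    intro i m
    induction m with
    | zero =>
      have hi : dir (t i) = i := ht i
      have := exponentSequence_succ_dir (c := c) (dir := dir) (t i)
      rw [hi] at this
      rw [add_zero, this]
      exact h _ (hnt i).le
    | succ m ih =>
      by_cases hi : i = dir (t i + 1 + m)
      · have := exponentSequence_succ_dir (c := c) (dir := dir) (t i + 1 + m)
        rw [← hi] at this
        rw [← add_assoc, this]
        exact h _ (by have := hnt i; omega)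
      · rwa [← add_assoc, exponentSequence_succ_of_ne hi]
  refine ⟨n + Finset.univ.sup (fun i => t i + 1), Nat.le_add_right _ _, fun m hm i => ?_⟩
  have h1 : t i + 1 ≤ Finset.univ.sup (fun i => t i + 1) :=
    Finset.le_sup (f := fun i => t i + 1) (Finset.mem_univ i)
  obtain ⟨k, rfl⟩ := Nat.exists_eq_add_of_le (show t i + 1 ≤ m by omega)
  exact key i k

/-- At some step the sum of the exponents does not lie strictly between the smallest and the largest
exponent: otherwise the largest exponent would decrease forever. -/
theorem exists_exponentSequence_le_sum_or_sum_le (hd : 0 < d) (hdir : ∀ i, {n | dir n = i}.Infinite) :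
    ∃ n, (∀ i, exponentSequence c dir n i ≤ ∑ j, exponentSequence c dir n j) ∨
      ∀ i, ∑ j, exponentSequence c dir n j ≤ exponentSequence c dir n i := by
  by_contra! H
  have upper : ∀ n B, (∀ i, exponentSequence c dir n i ≤ B) →
      ∀ m, ∀ i, exponentSequence c dir (n + m) i ≤ B := by
    intro n B hB m
    induction m with
    | zero => exact hB
    | succ m ih =>
      intro i
      by_cases hi : i = dir (n + m)
      · subst hi
        obtain ⟨l, hl⟩ := (H (n + m)).1
        rw [← add_assoc, exponentSequence_succ_dir]
        exact hl.le.trans (ih l)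
      · rw [← add_assoc, exponentSequence_succ_of_ne hi]
        exact ih i
  have lower : ∀ L, (∀ i, L ≤ c i) → ∀ m, ∀ i, L ≤ exponentSequence c dir m i := by
    intro L hL m
    induction m with
    | zero => exact hL
    | succ m ih =>
      intro i
      by_cases hi : i = dir m
      · subst hi
        obtain ⟨l, hl⟩ := (H m).2
        rw [exponentSequence_succ_dir]
        exact (ih l).trans hl.le
      · rw [exponentSequence_succ_of_ne hi]
        exact ih i
  obtain ⟨L, hL⟩ := (Set.finite_range c).bddBelow
  obtain ⟨B, hB⟩ := (Set.finite_range c).bddAbove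
  -- Every newly written exponent is a sum, hence at most the current bound minus `1`; once all
  -- directions have occurred the bound itself has dropped by `1`.
  have descend : ∀ k : ℕ, ∃ n, ∀ i, exponentSequence c dir n i ≤ B - k := by
    intro k
    induction k with
    | zero => exact ⟨0, fun i => by simpa [exponentSequence] using hB ⟨i, rfl⟩⟩
    | succ k ih =>
      obtain ⟨n, hn⟩ := ih
      obtain ⟨N, -, hN⟩ := exists_forall_exponentSequence (c := c) hdir n (· ≤ B - (k + 1 : ℕ)) <| by
        intro m hm
        obtain ⟨l, hl⟩ := (H m).1
        obtain ⟨e, rfl⟩ := Nat.exists_eq_add_of_le hm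
        have := upper n _ hn e l
        push_cast
        omega
      exact ⟨N, hN N le_rfl⟩
  -- This many drops push the upper bound to at most `L - 1`, below the permanent lower bound `L`.
  obtain ⟨n, hn⟩ := descend (B - L + 1).toNat
  have h1 := hn ⟨0, hd⟩
  have h2 := lower L (fun i => hL ⟨i, rfl⟩) n ⟨0, hd⟩
  omega

/-- With `s` the sum and `e` the exponent in the chosen direction, the next sum is `2 * s - e`. So
`e ≤ s` makes the sums nondecreasing and keeps them above all exponents. One strict inequality makes
all later ones strict; the sums then grow without bound, and the exponents become positive after
them. -/
theorem exists_exponentSequence_pos (hd : 2 ≤ d) (hdir : ∀ i, {n | dir n = i}.Infinite)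
    (hc : c ≠ 0) {n : ℕ}
    (hn : ∀ i, exponentSequence c dir n i ≤ ∑ j, exponentSequence c dir n j) :
    ∃ m, ∀ i, 0 < exponentSequence c dir m i := by
  have weak : ∀ m, ∀ i, exponentSequence c dir (n + m) i ≤ ∑ j, exponentSequence c dir (n + m) j := by
    intro m
    induction m with
    | zero => exact hn
    | succ m ih =>
      intro i
      have := ih (dir (n + m))
      rw [← add_assoc, sum_exponentSequence_succ]
      by_cases hi : i = dir (n + m)
      · subst hi
        rw [exponentSequence_succ_dir]
        linarith
      · rw [exponentSequence_succ_of_ne hi]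
        have := ih i
        linarith
  -- Otherwise each step replaces an exponent by itself. As all directions occur, every exponent
  -- equals the sum `s`, so `s = d * s`; since `2 ≤ d`, the vector vanishes.
  obtain ⟨t, ht⟩ : ∃ t, exponentSequence c dir (n + t) (dir (n + t)) <
      ∑ j, exponentSequence c dir (n + t) j := by
    by_contra! H
    have hconst : ∀ m, exponentSequence c dir (n + m) = exponentSequence c dir n := by
      intro m
      induction m with
      | zero => rfl
      | succ m ih =>
        rw [← ih]
        funext i
        by_cases hi : i = dir (n + m)
        · subst hi
          rw [← add_assoc, exponentSequence_succ_dir]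
          exact le_antisymm (H m) (weak m _)
        · rw [← add_assoc, exponentSequence_succ_of_ne hi]
    have heq : ∀ i, exponentSequence c dir n i = ∑ j, exponentSequence c dir n j := by
      intro i
      obtain ⟨k, hk, hnk⟩ := (hdir i).exists_gt n
      obtain ⟨e, rfl⟩ := Nat.exists_eq_add_of_le hnk.le
      have h1 := H e
      rw [hconst, show dir (n + e) = i from hk] at h1
      exact le_antisymm (hn i) h1
    have hsum : (∑ j, exponentSequence c dir n j) =
        d * ∑ j, exponentSequence c dir n j := by
      conv_lhs => rw [Finset.sum_congr rfl fun i _ => heq i]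
      simp
    have h0 : ∑ j, exponentSequence c dir n j = 0 := by
      have hd' : (2 : ℤ) ≤ d := by exact_mod_cast hd
      have : ((d : ℤ) - 1) * ∑ j, exponentSequence c dir n j = 0 := by linarith
      rcases mul_eq_zero.1 this with h | h
      · omega
      · exact h
    exact exponentSequence_ne_zero (dir := dir) hc n (funext fun i => (heq i).trans h0)
  have strict : ∀ m, ∀ i, exponentSequence c dir (n + t + 1 + m) i <
      ∑ j, exponentSequence c dir (n + t + 1 + m) j := by
    intro m
    induction m with
    | zero =>
      intro i
      rw [add_zero, sum_exponentSequence_succ]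
      by_cases hi : i = dir (n + t)
      · subst hi
        rw [exponentSequence_succ_dir]
        linarith
      · rw [exponentSequence_succ_of_ne hi]
        have := weak t i
        linarith
    | succ m ih =>
      intro i
      have := ih (dir (n + t + 1 + m))
      rw [← add_assoc, sum_exponentSequence_succ]
      by_cases hi : i = dir (n + t + 1 + m)
      · subst hi
        rw [exponentSequence_succ_dir]
        linarith
      · rw [exponentSequence_succ_of_ne hi]
        have := ih i
        linarith
  have grow : ∀ m : ℕ, (∑ j, exponentSequence c dir (n + t + 1) j) + m ≤
      ∑ j, exponentSequence c dir (n + t + 1 + m) j := by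
    intro m
    induction m with
    | zero => simp
    | succ m ih =>
      have := strict m (dir (n + t + 1 + m))
      rw [← add_assoc, sum_exponentSequence_succ (n + t + 1 + m)]
      push_cast
      linarith
  -- The sum grows by at least `1` per step, so after this many further steps it is at least `1`.
  obtain ⟨N, -, hN⟩ := exists_forall_exponentSequence (c := c) hdir
    (n + t + 1 + (1 - ∑ j, exponentSequence c dir (n + t + 1) j).toNat) (0 < ·) <| by
      intro m hm
      obtain ⟨e, rfl⟩ := Nat.exists_eq_add_of_le hm
      have := grow ((1 - ∑ j, exponentSequence c dir (n + t + 1) j).toNat + e)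
      rw [← add_assoc] at this
      push_cast at this
      omega
  exact ⟨N, hN N le_rfl⟩

/-- If every direction occurs infinitely often, every nontrivial Laurent monomial in the variables
of the first ring becomes, in the variables of some later ring, a monomial with positive exponents
or the inverse of one. -/
theorem exists_exponentSequence_pos_or_neg (hd : 2 ≤ d) (hdir : ∀ i, {n | dir n = i}.Infinite)
    (hc : c ≠ 0) :
    ∃ n, (∀ i, 0 < exponentSequence c dir n i) ∨ ∀ i, exponentSequence c dir n i < 0 := by
  obtain ⟨n, hn | hn⟩ := exists_exponentSequence_le_sum_or_sum_le (c := c) (by omega : 0 < d) hdir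
  · obtain ⟨m, hm⟩ := exists_exponentSequence_pos hd hdir hc hn
    exact ⟨m, Or.inl hm⟩
  · obtain ⟨m, hm⟩ := exists_exponentSequence_pos (c := -c) (n := n) hd hdir (neg_ne_zero.2 hc) <| by
      intro i
      simp only [exponentSequence_neg, Finset.sum_neg_distrib]
      exact neg_le_neg (hn i)
    refine ⟨m, Or.inr fun i => ?_⟩
    have := hm i
    rw [exponentSequence_neg] at this
    linarith

theorem monomialVariables_ne_zero {K : Type*} [Field K] {x : Fin d → K} (hx : ∀ i, x i ≠ 0)
    (n : ℕ) (i : Fin d) : monomialVariables x dir n i ≠ 0 := by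
  induction n generalizing i with
  | zero => exact hx i
  | succ n ih =>
    simp only [monomialVariables, transformVariables]
    split_ifs
    · exact ih _
    · exact div_ne_zero (ih _) (ih _)

/-- Each old variable other than the one in direction `w` is the new one times the new `w`-th
variable, which therefore collects all the exponents. -/
theorem prod_monomialVariables_zpow {K : Type*} [Field K] {x : Fin d → K} (hx : ∀ i, x i ≠ 0)
    (n : ℕ) :
    ∏ i, monomialVariables x dir n i ^ exponentSequence c dir n i = ∏ i, x i ^ c i := by
  induction n with
  | zero => rfl
  | succ n ih =>
    rw [← ih, ← Finset.mul_prod_erase _ _ (Finset.mem_univ (dir n)),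
      ← Finset.mul_prod_erase (Finset.univ (α := Fin d))
        (fun i => monomialVariables x dir n i ^ exponentSequence c dir n i)
        (Finset.mem_univ (dir n)),
      exponentSequence_succ_dir, ← Finset.add_sum_erase _ _ (Finset.mem_univ (dir n)),
      show monomialVariables x dir (n + 1) (dir n) = monomialVariables x dir n (dir n) by
        simp [monomialVariables, transformVariables],
      zpow_add₀ (monomialVariables_ne_zero hx n _), mul_assoc]
    congr 1
    have h0 : monomialVariables x dir n (dir n) ≠ 0 := monomialVariables_ne_zero hx n _
    have hpow : ∀ s : Finset (Fin d), monomialVariables x dir n (dir n) ^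
        (∑ j ∈ s, exponentSequence c dir n j) =
        ∏ j ∈ s, monomialVariables x dir n (dir n) ^ exponentSequence c dir n j := by
      intro s
      induction s using Finset.induction_on with
      | empty => simp
      | insert a s ha ihs => rw [Finset.sum_insert ha, Finset.prod_insert ha, zpow_add₀ h0, ihs]
    rw [hpow, ← Finset.prod_mul_distrib]
    refine Finset.prod_congr rfl fun i hi => ?_
    have hi := Finset.ne_of_mem_erase hi
    rw [exponentSequence_succ_of_ne hi]
    simp only [monomialVariables, transformVariables, if_neg hi]
    rw [← mul_zpow, mul_div_cancel₀ _ h0]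

end Exponents

/-! ### Finite monomial expansions with unit coefficients in a Noetherian local ring. -/

section MonomialExpansion

open IsLocalRing MvPolynomial

variable {R : Type*} [CommRing R] [IsLocalRing R] {d : ℕ} {x : Fin d → R}

/-- Up to a term of higher order, an element of `𝔪 ^ n` is a form of degree `n` in generators of `𝔪`
whose nonzero coefficients are units. -/
theorem exists_isHomogeneous_unit_coeff (hx : maximalIdeal R = Ideal.span (Set.range x)) {n : ℕ}
    {g : R} (hg : g ∈ maximalIdeal R ^ n) :
    ∃ p : MvPolynomial (Fin d) R, p.IsHomogeneous n ∧ (∀ a ∈ p.support, IsUnit (p.coeff a)) ∧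
      g - eval x p ∈ maximalIdeal R ^ (n + 1) := by
  classical
  rw [hx, Ideal.mem_span_pow_iff_exists_isHomogeneous] at hg
  obtain ⟨q, hq, rfl⟩ := hg
  have hdeg : ∀ a ∈ q.support, a.degree = n := fun a ha => by
    rw [Finsupp.degree_eq_weight_one]
    exact hq (mem_support_iff.1 ha)
  have hmono : ∀ a ∈ q.support, eval x (monomial a (1 : R)) ∈ maximalIdeal R ^ n := by
    intro a ha
    rw [hx, Ideal.mem_span_pow_iff_exists_isHomogeneous]
    exact ⟨_, isHomogeneous_monomial _ (hdeg a ha), rfl⟩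
  have hcoeff : ∀ a, (∑ b ∈ q.support with IsUnit (q.coeff b), monomial b (q.coeff b)).coeff a =
      if IsUnit (q.coeff a) then q.coeff a else 0 := by
    intro a
    simp only [coeff_sum, coeff_monomial, Finset.sum_ite_eq', Finset.mem_filter, mem_support_iff]
    by_cases h : IsUnit (q.coeff a)
    · simp [h, h.ne_zero]
    · simp [h]
  refine ⟨∑ a ∈ q.support with IsUnit (q.coeff a), monomial a (q.coeff a), ?_, ?_, ?_⟩
  · refine IsHomogeneous.sum _ _ _ fun a ha => isHomogeneous_monomial _
      (hdeg a (Finset.mem_filter.1 ha).1)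
  · intro a ha
    rw [mem_support_iff, hcoeff] at ha
    rw [hcoeff]
    split_ifs at ha ⊢ with h
    · exact h
    · exact absurd rfl ha
  -- The discarded coefficients are nonunits, hence in `𝔪`, so their terms lie in `𝔪 ^ (n + 1)`.
  · have hsum : eval x q = ∑ a ∈ q.support, eval x (monomial a (q.coeff a)) := by
      conv_lhs => rw [q.as_sum, map_sum]
    rw [hsum, map_sum, ← Finset.sum_filter_add_sum_filter_not q.support (fun a => IsUnit (q.coeff a)),
      add_sub_cancel_left]
    refine Ideal.sum_mem _ fun a ha => ?_
    rw [Finset.mem_filter] at ha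
    have h1 : eval x (monomial a (q.coeff a)) = q.coeff a * eval x (monomial a (1 : R)) := by
      simp [eval_monomial]
    rw [h1, pow_succ']
    exact Ideal.mul_mem_mul ((mem_maximalIdeal _).2 ha.2) (hmono a ha.1)

/-- The successive approximation of `f` by forms whose nonzero coefficients are units. -/
theorem exists_forms_unit_coeff (hx : maximalIdeal R = Ideal.span (Set.range x)) (f : R) :
    ∃ p : ℕ → MvPolynomial (Fin d) R, (∀ n, (p n).IsHomogeneous n) ∧
      (∀ n, ∀ a ∈ (p n).support, IsUnit ((p n).coeff a)) ∧
      ∀ n, f - ∑ k ∈ Finset.range n, eval x (p k) ∈ maximalIdeal R ^ n := by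
  choose! F hF using fun (n : ℕ) (g : R) (hg : g ∈ maximalIdeal R ^ n) =>
    exists_isHomogeneous_unit_coeff hx hg
  let r : ℕ → R := fun n => Nat.rec f (fun n g => g - eval x (F n g)) n
  have hr : ∀ n, r n ∈ maximalIdeal R ^ n := by
    intro n
    induction n with
    | zero => simp
    | succ n ih => exact (hF n _ ih).2.2
  refine ⟨fun n => F n (r n), fun n => (hF n _ (hr n)).1, fun n => (hF n _ (hr n)).2.1,
    fun n => ?_⟩
  suffices h : f - ∑ k ∈ Finset.range n, eval x (F k (r k)) = r n by
    rw [h]; exact hr n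
  induction n with
  | zero => simp [r]
  | succ n ih =>
    rw [Finset.sum_range_succ, ← sub_sub, ih]

/-- Ideals of a Noetherian local ring are closed. -/
theorem Ideal.mem_of_forall_mem_sup_pow [IsNoetherianRing R] {I : Ideal R} {h : R}
    (H : ∀ n, h ∈ I ⊔ maximalIdeal R ^ n) : h ∈ I := by
  -- Krull's intersection theorem for `R ⧸ I`.
  have hbot := Ideal.iInf_pow_smul_eq_bot_of_isLocalRing (M := R ⧸ I) (maximalIdeal R)
    (maximalIdeal.isMaximal R).ne_top
  rw [← Ideal.Quotient.eq_zero_iff_mem, ← Submodule.mem_bot R, ← hbot, Submodule.mem_iInf]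
  intro n
  obtain ⟨a, ha, b, hb, rfl⟩ := Submodule.mem_sup.1 (H n)
  rw [map_add, Ideal.Quotient.eq_zero_iff_mem.2 ha, zero_add]
  have : (Ideal.Quotient.mk I b) = b • (1 : R ⧸ I) := by
    rw [Algebra.smul_def, mul_one]; rfl
  rw [this]
  exact Submodule.smul_mem_smul hb Submodule.mem_top

/-- Every element of a Noetherian local ring is a sum of distinct monomials, with unit
coefficients, in given generators of the maximal ideal. -/
theorem exists_unit_monomial_expansion [IsNoetherianRing R]
    (hx : maximalIdeal R = Ideal.span (Set.range x)) (f : R) :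
    ∃ (E : Finset (Fin d → ℕ)) (u : (Fin d → ℕ) → Rˣ),
      f = ∑ a ∈ E, (u a : R) * monomialIn x a := by
  classical
  obtain ⟨p, hp, hu, hf⟩ := exists_forms_unit_coeff hx f
  let X : (Fin d →₀ ℕ) → R := fun a => ∏ i, x i ^ a i
  let S : Set (Fin d →₀ ℕ) := {a | a ∈ (p a.degree).support}
  have hdeg : ∀ n, ∀ a ∈ (p n).support, a.degree = n := by
    intro n a ha
    rw [Finsupp.degree_eq_weight_one]
    exact hp n (mem_support_iff.1 ha)
  -- Dickson's lemma: the minimal exponents occurring in the forms are finite in number.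
  have hfin : {a | Minimal (· ∈ S) a}.Finite :=
    WellQuasiOrderedLE.finite_of_isAntichain (setOfPred_minimal_antichain _)
  let E := hfin.toFinset
  have hE : ∀ a, a ∈ E ↔ Minimal (· ∈ S) a := fun a => by simp [E]
  -- A nonminimal monomial is a minimal one times a nontrivial monomial, hence lies in `I`. The
  -- factor `𝔪` ensures that absorbing `I` into the minimal terms changes their coefficients only by
  -- elements of `𝔪`, so units stay units.
  let I : Ideal R := maximalIdeal R • Ideal.span (X '' E)
  let c : (Fin d →₀ ℕ) → R := fun a => (p a.degree).coeff a
  have hXmul : ∀ a b, X (a + b) = X a * X b := fun a b => by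
    simp [X, pow_add, Finset.prod_mul_distrib]
  have hXmem : ∀ a, a ≠ 0 → X a ∈ maximalIdeal R := by
    intro a ha
    obtain ⟨i, hi⟩ := Finsupp.ne_iff.1 ha
    refine Ideal.mem_of_dvd _ (Finset.dvd_prod_of_mem _ (Finset.mem_univ i)) ?_
    refine Ideal.pow_mem_of_mem _ ?_ _ (Nat.pos_of_ne_zero hi)
    rw [hx]
    exact Ideal.subset_span ⟨i, rfl⟩
  have hI : ∀ a ∈ S, a ∉ E → X a ∈ I := by
    intro a ha haE
    obtain ⟨b, hba, hb⟩ := exists_minimal_le_of_wellFoundedLT (· ∈ S) a ha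
    obtain ⟨e, rfl⟩ := exists_add_of_le hba
    have he : e ≠ 0 := by
      rintro rfl
      exact haE ((hE _).2 (by simpa using hb))
    rw [hXmul, mul_comm]
    exact Submodule.smul_mem_smul (hXmem e he) (Ideal.subset_span ⟨b, (hE b).2 hb, rfl⟩)
  have heval : ∀ n, eval x (p n) = ∑ a ∈ (p n).support, c a * X a := by
    intro n
    rw [eval_eq']
    refine Finset.sum_congr rfl fun a ha => ?_
    simp only [c, X, hdeg n a ha]
  have hform : ∀ n, eval x (p n) - ∑ a ∈ E with a.degree = n, c a * X a ∈ I := by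
    intro n
    have hsub : (E.filter fun a => a.degree = n) ⊆ (p n).support := by
      intro a ha
      rw [Finset.mem_filter, hE] at ha
      have := ha.1.prop
      simp only [S, Set.mem_ofPred_eq, ha.2] at this
      exact this
    rw [heval, ← Finset.sum_sdiff hsub, add_sub_cancel_right]
    refine Ideal.sum_mem _ fun a ha => Ideal.mul_mem_left _ _ ?_
    rw [Finset.mem_sdiff, Finset.mem_filter] at ha
    have hd := hdeg n a ha.1
    exact hI a (by simp only [S, Set.mem_ofPred_eq, hd]; exact ha.1) fun h => ha.2 ⟨h, hd⟩
  have hmem : f - ∑ a ∈ E, c a * X a ∈ I := by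
    refine Ideal.mem_of_forall_mem_sup_pow fun n => ?_
    -- Beyond all degrees in `E`, so that the truncated sum already contains every minimal term.
    let N := max n (E.sup Finsupp.degree + 1)
    have hsum : ∑ k ∈ Finset.range N, ∑ a ∈ E with a.degree = k, c a * X a =
        ∑ a ∈ E, c a * X a := by
      refine Finset.sum_fiberwise_of_maps_to (fun a ha => ?_) _
      rw [Finset.mem_range]
      have := Finset.le_sup (f := Finsupp.degree) ha
      omega
    have hsplit : f - ∑ a ∈ E, c a * X a =
        (∑ k ∈ Finset.range N, (eval x (p k) - ∑ a ∈ E with a.degree = k, c a * X a)) +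
          (f - ∑ k ∈ Finset.range N, eval x (p k)) := by
      rw [Finset.sum_sub_distrib, hsum]; ring
    rw [hsplit]
    exact Submodule.add_mem_sup (Ideal.sum_mem _ fun k _ => hform k)
      (Ideal.pow_le_pow_right (le_max_left _ _) (hf N))
  obtain ⟨m, hm, hmsum⟩ := (Submodule.mem_ideal_smul_span_iff_exists_sum' _ _ _ _).1 hmem
  let m' : (Fin d →₀ ℕ) → R := fun a => if h : a ∈ (E : Set _) then m ⟨a, h⟩ else 0
  have hunit : ∀ a, ∃ u : Rˣ, a ∈ E → (u : R) = c a + m' a := by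
    intro a
    by_cases ha : a ∈ E
    · have h1 : IsUnit (c a) := hu _ a ((hE a).1 ha).prop
      have h2 : m' a ∈ maximalIdeal R := by
        simp only [m', dif_pos (Finset.mem_coe.2 ha)]
        exact hm _
      have h3 : IsUnit (c a + m' a) := by
        by_contra h
        have h4 := Ideal.sub_mem _ ((mem_maximalIdeal _).2 h) h2
        rw [add_sub_cancel_right] at h4
        exact (mem_maximalIdeal _).1 h4 h1
      exact ⟨h3.unit, fun _ => rfl⟩
    · exact ⟨1, fun h => absurd h ha⟩
  choose u hu' using hunit
  refine ⟨E.map Finsupp.equivFunOnFinite.toEmbedding,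
    fun a => u (Finsupp.equivFunOnFinite.symm a), ?_⟩
  have hfsum : ∑ a ∈ E, m' a * X a = f - ∑ a ∈ E, c a * X a := by
    rw [← hmsum, Finsupp.sum_fintype _ _ (by simp), ← Finset.sum_coe_sort E]
    refine Fintype.sum_congr _ _ fun a => ?_
    simp only [m', dif_pos (Finset.mem_coe.2 a.2)]
    rfl
  rw [Finset.sum_map, eq_add_of_sub_eq hfsum.symm, ← Finset.sum_add_distrib]
  refine Finset.sum_congr rfl fun a ha => ?_
  simp only [Equiv.coe_toEmbedding, Equiv.symm_apply_apply, hu' a ha]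
  rw [add_comm (c a), add_mul]
  rfl

end MonomialExpansion

/-! ### Consequences of independent values. -/

section Valuation

variable {R K Γ₀ : Type*} [CommRing R] [Field K] [Algebra R K]
  [LinearOrderedCommGroupWithZero Γ₀] {v : Valuation K Γ₀} {d : ℕ} {x : Fin d → R}

theorem map_monomialIn (a : Fin d → ℕ) :
    v (algebraMap R K (monomialIn x a)) = ∏ i, v (algebraMap R K (x i)) ^ a i := by
  simp [monomialIn]

theorem map_algebraMap_unit (hR : ∀ r, v (algebraMap R K r) ≤ 1) (u : Rˣ) :
    v (algebraMap R K u) = 1 := by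
  refine le_antisymm (hR _) ?_
  have h : v (algebraMap R K u) * v (algebraMap R K (u⁻¹ : Rˣ)) = 1 := by
    rw [← map_mul, ← map_mul, Units.mul_inv, map_one, map_one]
  calc 1 = v (algebraMap R K u) * v (algebraMap R K (u⁻¹ : Rˣ)) := h.symm
    _ ≤ v (algebraMap R K u) * 1 := mul_le_mul_right (hR _) _
    _ = _ := mul_one _

/-- A product of positive powers of elements less than `1` is less than `1`. -/
theorem prod_zpow_lt_one (hd : 0 < d) {g : Fin d → Γ₀} (hg : ∀ i, g i < 1)
    {c : Fin d → ℤ} (hc : ∀ i, 0 < c i) : ∏ i, g i ^ c i < 1 := by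
  have h : ∀ i, g i ^ c i < 1 := fun i => by
    obtain ⟨n, hn⟩ := Int.eq_ofNat_of_zero_le (hc i).le
    have := hc i
    rw [hn, zpow_natCast]
    exact pow_lt_one₀ zero_le (hg i) (by omega)
  rw [← Finset.mul_prod_erase _ _ (Finset.mem_univ (⟨0, hd⟩ : Fin d))]
  exact mul_lt_one_of_lt_of_le (h _) (Finset.prod_le_one' fun i _ => (h i).le)

/-- If all variables have values less than `1` at all stages, no nontrivial Laurent monomial has
value `1`. -/
theorem map_prod_zpow_ne_one (hd : 2 ≤ d) {dir : ℕ → Fin d} (hdir : ∀ i, {n | dir n = i}.Infinite)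
    {y : Fin d → K} (hy : ∀ i, y i ≠ 0) (hlt : ∀ n i, v (monomialVariables y dir n i) < 1)
    {c : Fin d → ℤ} (hc : c ≠ 0) : ∏ i, v (y i) ^ c i ≠ 1 := by
  obtain ⟨n, hn⟩ := exists_exponentSequence_pos_or_neg hd hdir hc
  have h : ∏ i, v (y i) ^ c i =
      ∏ i, v (monomialVariables y dir n i) ^ exponentSequence c dir n i := by
    simpa using (congrArg v (prod_monomialVariables_zpow (c := c) (dir := dir) hy n)).symm
  rw [h]
  rcases hn with hn | hn
  · exact (prod_zpow_lt_one (by omega) (hlt n) hn).ne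
  · intro h1
    refine (prod_zpow_lt_one (by omega) (hlt n)
      (c := -exponentSequence c dir n) fun i => ?_).ne ?_
    · simpa using hn i
    · simp [h1]

theorem map_monomialIn_injective (h0 : ∀ i, algebraMap R K (x i) ≠ 0)
    (hind : ∀ c : Fin d → ℤ, c ≠ 0 → ∏ i, v (algebraMap R K (x i)) ^ c i ≠ 1) :
    Function.Injective fun a : Fin d → ℕ => v (algebraMap R K (monomialIn x a)) := by
  intro a b hab
  by_contra hne
  refine hind (fun i => (a i : ℤ) - b i) (fun h => hne (funext fun i => ?_)) ?_
  · have := congrFun h i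
    simp only [Pi.zero_apply] at this
    omega
  · simp only [map_monomialIn] at hab
    have h1 : ∀ i, v (algebraMap R K (x i)) ≠ 0 := fun i => (v.ne_zero_iff).2 (h0 i)
    simp only [zpow_sub₀ (h1 _), zpow_natCast, Finset.prod_div_distrib]
    rw [hab]
    exact div_self (Finset.prod_ne_zero_iff.2 fun i _ => pow_ne_zero _ (h1 i))

/-- A nonempty sum of distinct monomials with unit coefficients has a leading term. -/
theorem exists_leading_term (hR : ∀ r, v (algebraMap R K r) ≤ 1)
    (h0 : ∀ i, algebraMap R K (x i) ≠ 0)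
    (hind : ∀ c : Fin d → ℤ, c ≠ 0 → ∏ i, v (algebraMap R K (x i)) ^ c i ≠ 1)
    {E : Finset (Fin d → ℕ)} (hE : E.Nonempty) (u : (Fin d → ℕ) → Rˣ) :
    ∃ a ∈ E, (∀ b ∈ E, v (algebraMap R K (monomialIn x b)) ≤ v (algebraMap R K (monomialIn x a))) ∧
      v (algebraMap R K (∑ b ∈ E, (u b : R) * monomialIn x b) -
        algebraMap R K (u a * monomialIn x a)) < v (algebraMap R K (monomialIn x a)) := by
  classical
  obtain ⟨a, ha, hmax⟩ := E.exists_max_image (fun a => v (algebraMap R K (monomialIn x a))) hE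
  refine ⟨a, ha, hmax, ?_⟩
  rw [← Finset.add_sum_erase _ _ ha, map_add, add_sub_cancel_left, map_sum]
  have hne : v (algebraMap R K (monomialIn x a)) ≠ 0 := by
    rw [map_monomialIn]
    exact Finset.prod_ne_zero_iff.2 fun i _ => pow_ne_zero _ ((v.ne_zero_iff).2 (h0 i))
  refine v.map_sum_lt hne fun b hb => ?_
  rw [map_mul, map_mul, map_algebraMap_unit hR, one_mul]
  exact lt_of_le_of_ne (hmax b (Finset.mem_of_mem_erase hb)) fun h =>
    Finset.ne_of_mem_erase hb (map_monomialIn_injective h0 hind h)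

theorem map_eq_of_leading_term (hR : ∀ r, v (algebraMap R K r) ≤ 1) {f : R} {u : Rˣ}
    {a : Fin d → ℕ} (h : v (algebraMap R K f - algebraMap R K (u * monomialIn x a)) <
      v (algebraMap R K (monomialIn x a))) :
    v (algebraMap R K f) = v (algebraMap R K (monomialIn x a)) := by
  have hu : v (algebraMap R K (u * monomialIn x a)) = v (algebraMap R K (monomialIn x a)) := by
    rw [map_mul, map_mul, map_algebraMap_unit hR, one_mul]
  rw [← sub_add_cancel (algebraMap R K f) (algebraMap R K (u * monomialIn x a)),
    v.map_add_eq_of_lt_right (by rwa [hu]), hu]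

/-- The values of the variables, viewed in the additively written value group. -/
noncomputable def variableValue (v : Valuation K Γ₀) (x : Fin d → R)
    (h0 : ∀ i, algebraMap R K (x i) ≠ 0) (i : Fin d) :
    MonoidWithZeroHom.valueGroup v.toMonoidWithZeroHom :=
  ⟨Units.mk0 (v (algebraMap R K (x i))) ((v.ne_zero_iff).2 (h0 i)),
    MonoidWithZeroHom.mem_valueGroup _ ⟨algebraMap R K (x i), rfl⟩⟩

theorem sum_smul_variableValue (h0 : ∀ i, algebraMap R K (x i) ≠ 0) (c : Fin d → ℤ) :
    (((∑ i, c i • Additive.ofMul (variableValue v x h0 i)).toMul : Γ₀ˣ) : Γ₀) =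
      ∏ i, v (algebraMap R K (x i)) ^ c i := by
  simp [variableValue, toMul_sum, toMul_zsmul]

variable [IsLocalRing R] [IsNoetherianRing R]

theorem isMonomialValuation_of_independent
    (hx : IsLocalRing.maximalIdeal R = Ideal.span (Set.range x))
    (hR : ∀ r, v (algebraMap R K r) ≤ 1) (h0 : ∀ i, algebraMap R K (x i) ≠ 0)
    (hind : ∀ c : Fin d → ℤ, c ≠ 0 → ∏ i, v (algebraMap R K (x i)) ^ c i ≠ 1) :
    IsMonomialValuation x v := by
  intro f hf
  refine ⟨exists_unit_monomial_expansion hx f, fun E u hfE => ?_⟩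
  have hE : E.Nonempty := by
    rw [Finset.nonempty_iff_ne_empty]
    rintro rfl
    exact hf (by simpa using hfE)
  obtain ⟨a, ha, hmax, hlt⟩ := exists_leading_term hR h0 hind hE u
  rw [← hfE] at hlt
  rw [map_eq_of_leading_term hR hlt]
  exact ⟨⟨a, ha, rfl⟩, fun _ ⟨b, hb, h⟩ => h ▸ hmax b hb⟩

theorem exists_leading_term_of_ne_zero
    (hx : IsLocalRing.maximalIdeal R = Ideal.span (Set.range x))
    (hR : ∀ r, v (algebraMap R K r) ≤ 1) (h0 : ∀ i, algebraMap R K (x i) ≠ 0)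
    (hind : ∀ c : Fin d → ℤ, c ≠ 0 → ∏ i, v (algebraMap R K (x i)) ^ c i ≠ 1)
    {f : R} (hf : f ≠ 0) : ∃ (u : Rˣ) (a : Fin d → ℕ),
      v (algebraMap R K f - algebraMap R K (u * monomialIn x a)) <
        v (algebraMap R K (monomialIn x a)) := by
  obtain ⟨E, u, hfE⟩ := exists_unit_monomial_expansion hx f
  have hE : E.Nonempty := by
    rw [Finset.nonempty_iff_ne_empty]
    rintro rfl
    exact hf (by simpa using hfE)
  obtain ⟨a, -, -, hlt⟩ := exists_leading_term hR h0 hind hE u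
  exact ⟨u a, a, by rwa [← hfE] at hlt⟩

variable [IsFractionRing R K]

/-- The values of elements of `K` are values of Laurent monomials. -/
theorem exists_map_eq_prod_zpow
    (hx : IsLocalRing.maximalIdeal R = Ideal.span (Set.range x))
    (hR : ∀ r, v (algebraMap R K r) ≤ 1) (h0 : ∀ i, algebraMap R K (x i) ≠ 0)
    (hind : ∀ c : Fin d → ℤ, c ≠ 0 → ∏ i, v (algebraMap R K (x i)) ^ c i ≠ 1)
    {k : K} (hk : k ≠ 0) : ∃ c : Fin d → ℤ, v k = ∏ i, v (algebraMap R K (x i)) ^ c i := by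
  obtain ⟨f, h, hh, rfl⟩ := IsFractionRing.div_surjective (A := R) k
  have hf0 : f ≠ 0 := by rintro rfl; simp at hk
  obtain ⟨u, a, ha⟩ := exists_leading_term_of_ne_zero hx hR h0 hind hf0
  obtain ⟨w, b, hb⟩ := exists_leading_term_of_ne_zero hx hR h0 hind (nonZeroDivisors.ne_zero hh)
  refine ⟨fun i => (a i : ℤ) - b i, ?_⟩
  have h1 : ∀ i, v (algebraMap R K (x i)) ≠ 0 := fun i => (v.ne_zero_iff).2 (h0 i)
  simp only [zpow_sub₀ (h1 _), zpow_natCast, Finset.prod_div_distrib]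
  rw [map_div₀, map_eq_of_leading_term hR ha, map_eq_of_leading_term hR hb, map_monomialIn,
    map_monomialIn]

/-- Every element of the valuation ring is congruent to an element of `R`. -/
theorem exists_map_sub_algebraMap_lt_one
    (hx : IsLocalRing.maximalIdeal R = Ideal.span (Set.range x))
    (hR : ∀ r, v (algebraMap R K r) ≤ 1) (h0 : ∀ i, algebraMap R K (x i) ≠ 0)
    (hind : ∀ c : Fin d → ℤ, c ≠ 0 → ∏ i, v (algebraMap R K (x i)) ^ c i ≠ 1)
    {k : K} (hk : v k ≤ 1) : ∃ r : R, v (k - algebraMap R K r) < 1 := by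
  rcases hk.lt_or_eq with hk | hk
  · exact ⟨0, by simpa using hk⟩
  obtain ⟨f, h, hh, rfl⟩ := IsFractionRing.div_surjective (A := R) k
  have hf0 : f ≠ 0 := by rintro rfl; simp at hk
  have hhK : algebraMap R K h ≠ 0 := IsFractionRing.to_map_ne_zero_of_mem_nonZeroDivisors hh
  have hhv : v (algebraMap R K h) ≠ 0 := (v.ne_zero_iff).2 hhK
  obtain ⟨u, a, ha⟩ := exists_leading_term_of_ne_zero hx hR h0 hind hf0
  obtain ⟨w, b, hb⟩ := exists_leading_term_of_ne_zero hx hR h0 hind (nonZeroDivisors.ne_zero hh)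
  rw [map_div₀, div_eq_one_iff_eq hhv] at hk
  have hva := map_eq_of_leading_term hR ha
  have hvb := map_eq_of_leading_term hR hb
  obtain rfl : a = b := map_monomialIn_injective h0 hind (hva.symm.trans (hk.trans hvb))
  -- Numerator and denominator have the same dominant monomial, so the quotient is congruent to the
  -- ratio of its unit coefficients.
  refine ⟨u * (w⁻¹ : Rˣ), ?_⟩
  have hw : algebraMap R K w * algebraMap R K (w⁻¹ : Rˣ) = 1 := by
    rw [← map_mul, Units.mul_inv, map_one]
  have key : algebraMap R K f / algebraMap R K h - algebraMap R K (u * (w⁻¹ : Rˣ)) =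
      ((algebraMap R K f - algebraMap R K (u * monomialIn x a)) -
        algebraMap R K (u * (w⁻¹ : Rˣ)) *
          (algebraMap R K h - algebraMap R K (w * monomialIn x a))) / algebraMap R K h := by
    rw [eq_div_iff hhK, sub_mul, div_mul_cancel₀ _ hhK]
    simp only [map_mul]
    linear_combination (-algebraMap R K u * algebraMap R K (monomialIn x a)) * hw
  rw [key, map_div₀, div_lt_one₀ (zero_lt_iff.2 hhv)]
  refine v.map_sub_lt (by rwa [hvb]) ?_
  rw [← Units.val_mul, map_mul, map_algebraMap_unit hR, one_mul, hvb]
  exact hb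

/-- Every residue class of the valuation ring comes from `R`, so the residue extension is trivial.
-/
theorem hasDimensionOver_zero_of_independent
    (hx : IsLocalRing.maximalIdeal R = Ideal.span (Set.range x))
    (hR : ∀ r, v (algebraMap R K r) ≤ 1) (hlt : ∀ i, v (algebraMap R K (x i)) < 1)
    (h0 : ∀ i, algebraMap R K (x i) ≠ 0)
    (hind : ∀ c : Fin d → ℤ, c ≠ 0 → ∏ i, v (algebraMap R K (x i)) ^ c i ≠ 1) :
    HasDimensionOver R v.valuationSubring 0 := by
  have hm : ∀ r ∈ IsLocalRing.maximalIdeal R, v (algebraMap R K r) < 1 := by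
    intro r hr
    rw [hx] at hr
    induction hr using Submodule.span_induction with
    | mem r hr => obtain ⟨i, rfl⟩ := hr; exact hlt i
    | zero => simp
    | add r s _ _ hr hs => rw [map_add]; exact v.map_add_lt hr hs
    | smul r s _ hs =>
      rw [smul_eq_mul, map_mul, map_mul]
      exact mul_lt_one_of_nonneg_of_lt_one_right (hR r) zero_le hs
  have hmem : ∀ r, algebraMap R K r ∈ v.valuationSubring := hR
  have hloc : IsLocalHom ((algebraMap R K).codRestrict v.valuationSubring hmem) := by
    refine ⟨fun r hr => ?_⟩
    by_contra h
    exact (IsLocalRing.mem_maximalIdeal _).1 ((Valuation.mem_maximalIdeal_iff K v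
      (a := (algebraMap R K).codRestrict _ hmem r)).2
      (hm r ((IsLocalRing.mem_maximalIdeal _).2 h))) hr
  refine ⟨hmem, hloc, ?_⟩
  let : Algebra (IsLocalRing.ResidueField R) (IsLocalRing.ResidueField v.valuationSubring) :=
    (IsLocalRing.ResidueField.map ((algebraMap R K).codRestrict v.valuationSubring hmem)).toAlgebra
  refine trdeg_eq_zero_iff.2 ⟨fun z => ?_⟩
  obtain ⟨⟨k, hk⟩, rfl⟩ := IsLocalRing.residue_surjective z
  obtain ⟨r, hr⟩ := exists_map_sub_algebraMap_lt_one hx hR h0 hind hk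
  have : IsLocalRing.residue v.valuationSubring ⟨k, hk⟩ =
      algebraMap (IsLocalRing.ResidueField R) _ (IsLocalRing.residue R r) := by
    change _ = IsLocalRing.ResidueField.map _ (IsLocalRing.residue R r)
    rw [IsLocalRing.ResidueField.map_residue, ← sub_eq_zero, ← map_sub,
      IsLocalRing.residue_eq_zero_iff]
    exact (Valuation.mem_maximalIdeal_iff K v).2 hr
  rw [this]
  exact isAlgebraic_algebraMap _

/-- An integral basis, stronger than a rational one; base change to `ℚ` yields both the rational
rank and the rational independence. -/
theorem exists_basis_addValueGroup
    (hx : IsLocalRing.maximalIdeal R = Ideal.span (Set.range x))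
    (hR : ∀ r, v (algebraMap R K r) ≤ 1) (h0 : ∀ i, algebraMap R K (x i) ≠ 0)
    (hind : ∀ c : Fin d → ℤ, c ≠ 0 → ∏ i, v (algebraMap R K (x i)) ^ c i ≠ 1) :
    ∃ b : Module.Basis (Fin d) ℤ (AddValueGroup v),
      ∀ i, b i = Additive.ofMul (variableValue v x h0 i) := by
  have hli : LinearIndependent ℤ fun i => Additive.ofMul (variableValue v x h0 i) := by
    rw [Fintype.linearIndependent_iff]
    intro c hc
    by_contra! h
    refine hind c (fun h' => ?_) ?_
    · obtain ⟨i, hi⟩ := h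
      exact hi (congrFun h' i)
    · rw [← sum_smul_variableValue h0, hc]
      simp
  have hspan : ⊤ ≤ Submodule.span ℤ
      (Set.range fun i => Additive.ofMul (variableValue v x h0 i)) := by
    intro g _
    have hg : ((g.toMul : Γ₀ˣ) : Γ₀) ∈ Units.val ''
        (MonoidWithZeroHom.valueGroup v.toMonoidWithZeroHom : Set Γ₀ˣ) := ⟨_, g.toMul.2, rfl⟩
    -- Over a field, each element of the value group is the value of a single nonzero `k`.
    rw [MonoidWithZeroHom.valueGroup_eq_range] at hg
    obtain ⟨⟨k, hk⟩, hne⟩ := hg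
    have hk0 : k ≠ 0 := by
      rintro rfl
      exact hne (hk.symm.trans (map_zero _))
    obtain ⟨c, hc⟩ := exists_map_eq_prod_zpow hx hR h0 hind hk0
    have : g = ∑ i, c i • Additive.ofMul (variableValue v x h0 i) := by
      apply Additive.toMul.injective
      apply Subtype.ext
      apply Units.ext
      rw [sum_smul_variableValue, ← hc]
      exact hk.symm
    rw [this]
    exact Submodule.sum_mem _ fun i _ =>
      Submodule.smul_mem _ _ (Submodule.subset_span ⟨i, rfl⟩)
  exact ⟨Module.Basis.mk hli hspan, fun i => Module.Basis.mk_apply hli hspan i⟩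

end Valuation

/-! ### The variables of the rings `A n` have values less than `1`. -/

section Sequence

open IsLocalRing

theorem IsMonomialQuadraticTransform.toSubring_le {K : Type*} [Field K] {d : ℕ} {A B : LocalSubring K}
    {x : Fin d → K} {w : Fin d} (h : IsMonomialQuadraticTransform A x w B) :
    A.toSubring ≤ B.toSubring := by
  obtain ⟨P, hP, -, rfl⟩ := h
  exact (Set.subset_union_left.trans Subring.subset_closure).trans (LocalSubring.le_ofPrime _ P)

theorem IsMonomialQuadraticTransform.transformVariables_mem {K : Type*} [Field K] {d : ℕ}
    {A B : LocalSubring K} {x : Fin d → K} {w : Fin d} (h : IsMonomialQuadraticTransform A x w B)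
    (hx : ∀ i, ∃ hi : x i ∈ A.toSubring, ⟨x i, hi⟩ ∈ maximalIdeal A.toSubring) (i : Fin d) :
    ∃ hi : transformVariables x w i ∈ B.toSubring,
      ⟨transformVariables x w i, hi⟩ ∈ maximalIdeal B.toSubring := by
  obtain ⟨P, hP, hspan, rfl⟩ := h
  have hD : transformVariables x w i ∈ quadraticDilatation A (x w) := by
    apply Subring.subset_closure
    unfold transformVariables
    split_ifs with hi
    · exact Or.inl (hx w).1
    · exact Or.inr ⟨_, (hx i).2, rfl⟩
  have hmem : (⟨_, hD⟩ : quadraticDilatation A (x w)) ∈ P := by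
    rw [hspan]
    exact Ideal.subset_span ⟨i, rfl⟩
  exact ⟨LocalSubring.le_ofPrime _ P hD, (IsLocalization.AtPrime.to_map_mem_maximal_iff
    (LocalSubring.ofPrime (quadraticDilatation A (x w)) P).toSubring P ⟨_, hD⟩).2 hmem⟩

variable {R K : Type*} [CommRing R] [Field K] [Algebra R K] {d : ℕ} {x : Fin d → R} {dir : ℕ → Fin d} {A : ℕ → LocalSubring K}

namespace IsMonomialQuadraticSequence

theorem monotone (hA : IsMonomialQuadraticSequence x dir A) :
    Monotone fun n => (A n).toSubring :=
  monotone_nat_of_le_succ fun n => (hA.2 n).toSubring_le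

variable [IsLocalRing R] [IsFractionRing R K]

theorem monomialVariables_mem (hA : IsMonomialQuadraticSequence x dir A)
    (hx : ∀ i, x i ∈ maximalIdeal R) (n : ℕ) (i : Fin d) :
    ∃ h : monomialVariables (fun i => algebraMap R K (x i)) dir n i ∈ (A n).toSubring,
      ⟨_, h⟩ ∈ maximalIdeal (A n).toSubring := by
  induction n generalizing i with
  | zero =>
    have h : algebraMap R K (x i) ∈ (A 0).toSubring := by
      rw [hA.1]
      exact ⟨x i, rfl⟩
    refine ⟨h, (mem_maximalIdeal _).2 fun hu => ?_⟩
    obtain ⟨⟨b, hb⟩, hab⟩ := hu.exists_right_inv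
    rw [hA.1] at hb
    obtain ⟨r, rfl⟩ := hb
    have h1 : algebraMap R K (x i * r) = algebraMap R K 1 := by
      rw [map_mul, map_one]
      exact congrArg Subtype.val hab
    exact (mem_maximalIdeal _).1 (hx i)
      (IsUnit.of_mul_eq_one r (IsFractionRing.injective R K h1))
  | succ n ih => exact (hA.2 n).transformVariables_mem ih i

/-- This keeps the variables of `A n` nonunits in all later rings: each is a multiple there of a
current variable, which lies in the maximal ideal. -/
theorem exists_eq_mul (hA : IsMonomialQuadraticSequence x dir A)
    (hx : ∀ i, x i ∈ maximalIdeal R) (h0 : ∀ i, algebraMap R K (x i) ≠ 0) (n k : ℕ) (i : Fin d) :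
    ∃ j, ∃ s ∈ (A (n + k)).toSubring, monomialVariables (fun i => algebraMap R K (x i)) dir n i =
      monomialVariables (fun i => algebraMap R K (x i)) dir (n + k) j * s := by
  induction k with
  | zero => exact ⟨i, 1, one_mem _, (mul_one _).symm⟩
  | succ k ih =>
    obtain ⟨j, s, hs, h⟩ := ih
    have hs' := (hA.2 (n + k)).toSubring_le hs
    by_cases hj : j = dir (n + k)
    · refine ⟨j, s, hs', ?_⟩
      rw [h, ← add_assoc]
      simp [monomialVariables, transformVariables, hj]
    · refine ⟨j, monomialVariables (fun i => algebraMap R K (x i)) dir (n + k + 1) (dir (n + k)) * s,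
        mul_mem (hA.monomialVariables_mem hx _ _).1 hs', ?_⟩
      rw [h, ← add_assoc, ← mul_assoc]
      simp only [monomialVariables, transformVariables, if_neg hj, if_true]
      rw [div_mul_cancel₀ _ (monomialVariables_ne_zero h0 _ _)]

/-- A variable that is a unit of the valuation ring would, by domination, have its inverse in the
union, hence in some `A k`. In `A (n + k)` that would make a variable a unit. -/
theorem map_monomialVariables_lt_one {Γ₀ : Type*} [LinearOrderedCommGroupWithZero Γ₀]
    {v : Valuation K Γ₀} (hA : IsMonomialQuadraticSequence x dir A)
    (hx : ∀ i, x i ∈ maximalIdeal R) (h0 : ∀ i, algebraMap R K (x i) ≠ 0)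
    (hV : BirationallyDominates (⨆ n, (A n).toSubring : Subring K) v.valuationSubring)
    (n : ℕ) (i : Fin d) : v (monomialVariables (fun i => algebraMap R K (x i)) dir n i) < 1 := by
  obtain ⟨hmem, hloc⟩ := hV
  set y := monomialVariables (fun i => algebraMap R K (x i)) dir
  have hyS : y n i ∈ (⨆ n, (A n).toSubring : Subring K) :=
    le_iSup (fun n => (A n).toSubring) n (hA.monomialVariables_mem hx n i).1
  refine (Valuation.mem_maximalIdeal_iff K v (a := ⟨y n i, hmem ⟨_, hyS⟩⟩)).1
    ((mem_maximalIdeal _).2 fun hu => ?_)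
  obtain ⟨⟨z, hz⟩, hyz⟩ := (hloc.map_nonunit ⟨y n i, hyS⟩ hu).exists_right_inv
  rw [Subring.mem_iSup_of_directed hA.monotone.directed_le] at hz
  obtain ⟨k, hk⟩ := hz
  obtain ⟨j, s, hs, hys⟩ := hA.exists_eq_mul hx h0 n k i
  obtain ⟨hj, hjm⟩ := hA.monomialVariables_mem hx (n + k) j
  have hzs : s * z ∈ (A (n + k)).toSubring :=
    mul_mem hs (hA.monotone (Nat.le_add_left k n) hk)
  refine (mem_maximalIdeal _).1 hjm (IsUnit.of_mul_eq_one ⟨s * z, hzs⟩ (Subtype.ext ?_))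
  have h1 : y n i * z = 1 := congrArg Subtype.val hyz
  rw [show y n i = y (n + k) j * s from hys, mul_assoc] at h1
  exact h1

end IsMonomialQuadraticSequence

/-- Regular parameters are nonzero. -/
theorem ne_zero_of_maximalIdeal_eq_span {R : Type*} [CommRing R] [IsLocalRing R]
    [IsNoetherianRing R] {d : ℕ} (hdim : ringKrullDim R = d) {x : Fin d → R}
    (hx : maximalIdeal R = Ideal.span (Set.range x)) (i : Fin d) : x i ≠ 0 := by
  classical
  intro hi
  -- A zero generator can be dropped, leaving `d - 1` generators, which is fewer than Krull's height
  -- theorem allows in dimension `d`.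
  have hspan : maximalIdeal R = Ideal.span (x '' (Finset.univ.erase i : Finset (Fin d))) := by
    rw [hx]
    refine le_antisymm (Ideal.span_le.2 ?_) (Ideal.span_mono (Set.image_subset_range _ _))
    rintro _ ⟨j, rfl⟩
    by_cases hj : j = i
    · rw [hj, hi]
      exact zero_mem _
    · exact Ideal.subset_span ⟨j, by simpa using hj, rfl⟩
  have h1 : ((maximalIdeal R).spanFinrank : ℕ) ≤ d - 1 := by
    rw [hspan]
    refine (Submodule.spanFinrank_span_le_ncard_of_finite (Set.toFinite _)).trans
      ((Set.ncard_image_le (Set.toFinite _)).trans ?_)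
    rw [Set.ncard_coe_finset, Finset.card_erase_of_mem (Finset.mem_univ i), Finset.card_univ,
      Fintype.card_fin]
  have h2 := ringKrullDim_le_spanFinrank_maximalIdeal R
  rw [hdim] at h2
  have h3 : d ≤ (maximalIdeal R).spanFinrank := by exact_mod_cast h2
  have := i.pos
  omega

end Sequence

theorem mainTheorem6 {R K : Type*} [CommRing R] [IsDomain R] [IsRegularLocalRing R]
    [Field K] [Algebra R K] [IsFractionRing R K]
    (d : ℕ) (hd : 2 ≤ d) (hdim : ringKrullDim R = d)
    (x : Fin d → R) (hx : IsLocalRing.maximalIdeal R = Ideal.span (Set.range x))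
    (dir : ℕ → Fin d) (A : ℕ → LocalSubring K)
    (hA : IsMonomialQuadraticSequence x dir A)
    (hdir : ∀ i, {n | dir n = i}.Infinite)
    (V : ValuationSubring K)
    (hV : BirationallyDominates (⨆ n, (A n).toSubring : Subring K) V)
    {Γ₀ : Type*} [LinearOrderedCommGroupWithZero Γ₀] (v : Valuation K Γ₀)
    (hv : v.valuationSubring = V) :
    ratRank v = d ∧
    HasDimensionOver R V 0 ∧
    RationallyIndependentValues v (fun i => algebraMap R K (x i)) ∧
    IsMonomialValuation x v := by
  subst hv
  have h0 : ∀ i, algebraMap R K (x i) ≠ 0 := fun i =>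
    (map_ne_zero_iff _ (IsFractionRing.injective R K)).2 (ne_zero_of_maximalIdeal_eq_span hdim hx i)
  have hxm : ∀ i, x i ∈ IsLocalRing.maximalIdeal R := fun i => hx ▸ Ideal.subset_span ⟨i, rfl⟩
  have hlt := hA.map_monomialVariables_lt_one hxm h0 hV
  have hind : ∀ c : Fin d → ℤ, c ≠ 0 → ∏ i, v (algebraMap R K (x i)) ^ c i ≠ 1 := fun c hc =>
    map_prod_zpow_ne_one hd hdir h0 hlt hc
  have hR : ∀ r, v (algebraMap R K r) ≤ 1 := by
    intro r
    have hr : algebraMap R K r ∈ (⨆ n, (A n).toSubring : Subring K) := by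
      refine le_iSup (fun n => (A n).toSubring) 0 ?_
      rw [hA.1]
      exact ⟨r, rfl⟩
    exact hV.1 ⟨_, hr⟩
  obtain ⟨b, hb⟩ := exists_basis_addValueGroup hx hR h0 hind
  refine ⟨?_, hasDimensionOver_zero_of_independent hx hR (hlt 0) h0 hind,
    ⟨variableValue v x h0, fun i => rfl, ?_⟩, isMonomialValuation_of_independent hx hR h0 hind⟩
  · rw [ratRank, rank_eq_card_basis (b.baseChange ℚ), Fintype.card_fin]
  · simp only [← hb, ← Module.Basis.baseChange_apply]
    exact (b.baseChange ℚ).linearIndependent
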